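/- All graphs are finite, simple and undirected. A set $D$ of vertices of a graph $G$ is a \emph{dominating set} if every vertex of $G$ outside $D$ has a neighbour in $D$; a dominating set $D$ is \emph{certified} if every vertex of $D$ has either zero or at least two neighbours outside $D$. Let $\gamma_{\mathrm{cer}}(G)$ denote the minimum cardinality of a certified dominating set of $G$. Write $G+v$ for a graph obtained from $G$ by adding one new vertex $v$ and joining it to some set (possibly empty) of vertices of $G$; the new vertex $v$ is called a \emph{leaf} if its degree in $G+v$ is exactly one. \textbf{Theorem.} (a) Let $G$ be any graph, not necessarily connected. If a new vertex $v$ that is not a leaf of $G+v$ is added to $G$, then $$\gamma_{\mathrm{cer}}(G+v)\le \gamma_{\mathrm{cer}}(G)+1 .$$ (b) By contrast, adding a leaf can increase $\gamma_{\mathrm{cer}}$ by an arbitrarily large amount: for every integer $i\ge 1$ there are a graph $G$ on $2i+1$ vertices and a graph $G+v$, in which the new vertex $v$ is a leaf, such that $$\gamma_{\mathrm{cer}}(G)=i \quad\text{and}\quad \gamma_{\mathrm{cer}}(G+v)=2i+2 .$$ -/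

import Mathlib

namespace SimpleGraph

variable {V : Type*}

/-- Every vertex outside `D` has a neighbour in `D`. -/
def IsDominating (G : SimpleGraph V) (D : Set V) : Prop :=
  ∀ v, v ∉ D → ∃ w ∈ D, G.Adj v w

/-- A dominating set `D` is certified if every vertex of `D` has either zero or at least two
neighbours outside `D`. -/
def IsCertifiedDominating (G : SimpleGraph V) (D : Set V) : Prop :=
  G.IsDominating D ∧
    ∀ v ∈ D, (G.neighborSet v \ D).encard = 0 ∨ 2 ≤ (G.neighborSet v \ D).encard

/-- The minimum cardinality of a certified dominating set (of a finite graph). -/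
noncomputable def certifiedDominationNumber (G : SimpleGraph V) : ℕ :=
  sInf {n | ∃ D : Finset V, G.IsCertifiedDominating (D : Set V) ∧ D.card = n}

/-- The graph obtained from `G` by adding one new vertex `none`, joined exactly to the vertices
in `S`. -/
def addVertex (G : SimpleGraph V) (S : Set V) : SimpleGraph (Option V) where
  Adj
    | some a, some b => G.Adj a b
    | some a, none => a ∈ S
    | none, some b => b ∈ S
    | none, none => False
  symm := ⟨by
    rintro (_ | a) (_ | b) h
    · exact h
    · exact h
    · exact h
    · exact G.adj_symm h⟩
  loopless := ⟨by
    rintro (_ | a) h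
    · exact h
    · exact G.irrefl h⟩

theorem isCertifiedDominating_univ (G : SimpleGraph V) :
    G.IsCertifiedDominating Set.univ := by
  simp [IsCertifiedDominating, IsDominating]

/-- For a finite graph the certified domination number is an attained minimum. -/
theorem isLeast_certifiedDominationNumber [Finite V] (G : SimpleGraph V) :
    IsLeast {n | ∃ D : Finset V, G.IsCertifiedDominating (D : Set V) ∧ D.card = n}
      G.certifiedDominationNumber := by
  have := Fintype.ofFinite V
  refine ⟨Nat.sInf_mem ⟨_, Finset.univ, ?_, rfl⟩, fun n hn => Nat.sInf_le hn⟩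
  simpa using G.isCertifiedDominating_univ

end SimpleGraph

namespace SimpleGraph

variable {V : Type*} {G : SimpleGraph V} {D R S : Set V}

/-! Part (a). Take a minimum certified dominating set `D` of `G`; `S` is the neighbourhood of the
new vertex v. The set `D ∪ {v}` works unless `S` has exactly one vertex w outside `D`. In that case
some shadowed vertices are moved out of `D`. If every shadowed vertex of `S` has a pendant neighbour
outside `S`, those pendant vertices leave `D`, and v stays out as well: each affected vertex then
has v and a pendant vertex as outside neighbours. Otherwise some shadowed a in `S` has all its
pendant neighbours in `S`. A removable set containing a, or such a pendant neighbour, leaves `D` and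
v enters; v then has a second outside neighbour besides w. Minimality of `D` supplies the structure
needed: no nonempty set is removable in `G` itself (`IsRemovable.eq_empty`), which forces pendant
neighbours (`exists_isPendant_adj`). Part (b). In the subdivided star the middle vertices suffice,
but a leaf at the centre forces every vertex into the set. -/

theorem isCertifiedDominating_iff :
    G.IsCertifiedDominating D ↔ (∀ v ∉ D, ∃ w ∈ D, G.Adj v w) ∧
      ∀ v ∈ D, ∀ x ∉ D, G.Adj v x → ∃ y ∉ D, y ≠ x ∧ G.Adj v y := by
  refine and_congr Iff.rfl (forall₂_congr fun v _ => ?_)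
  constructor
  · rintro (h | h) x hx hvx
    · rw [Set.encard_eq_zero] at h
      exact absurd (show x ∈ G.neighborSet v \ D from ⟨hvx, hx⟩) (by simp [h])
    · obtain ⟨a, b, ha, hb, hab⟩ := Set.one_lt_encard_iff.1
        (lt_of_lt_of_le (by norm_num) h : 1 < (G.neighborSet v \ D).encard)
      by_cases hax : a = x
      · exact ⟨b, hb.2, fun h => hab (hax.trans h.symm), hb.1⟩
      · exact ⟨a, ha.2, hax, ha.1⟩
  · intro h
    rcases (G.neighborSet v \ D).eq_empty_or_nonempty with h0 | ⟨x, hvx, hx⟩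
    · exact Or.inl (by simp [h0])
    · obtain ⟨y, hy, hyx, hvy⟩ := h x hx hvx
      exact Or.inr (Order.add_one_le_of_lt
        (Set.one_lt_encard_iff.2 ⟨y, x, And.intro hvy hy, And.intro hvx hx, hyx⟩))

theorem certifiedDominationNumber_le [Finite V] (h : G.IsCertifiedDominating D) :
    G.certifiedDominationNumber ≤ D.ncard := by
  refine G.isLeast_certifiedDominationNumber.2 ⟨D.toFinite.toFinset, by simpa using h, ?_⟩
  rw [Set.ncard_eq_toFinset_card D]

theorem exists_isCertifiedDominating_ncard_eq [Finite V] (G : SimpleGraph V) :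
    ∃ D : Set V, G.IsCertifiedDominating D ∧ D.ncard = G.certifiedDominationNumber := by
  obtain ⟨D, hD, h⟩ := G.isLeast_certifiedDominationNumber.1
  exact ⟨D, hD, by simpa using h⟩

/-! ### Shadowed vertices and removable sets -/

/-- The vertices of `D` without neighbours outside `D`. -/
def shadowed (G : SimpleGraph V) (D : Set V) : Set V :=
  {z | z ∈ D ∧ ∀ x, G.Adj z x → x ∈ D}

/-- `x` has exactly one neighbour. -/
def IsPendant (G : SimpleGraph V) (x : V) : Prop :=
  ∃ y, G.Adj x y ∧ ∀ z, G.Adj x z → z = y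

/-- `R` consists of shadowed vertices that can be taken out of `D` without spoiling the
certification of the vertices that stay; vertices in `A` are dominated from elsewhere. -/
structure IsRemovable (G : SimpleGraph V) (D A R : Set V) : Prop where
  subset : R ⊆ G.shadowed D
  dominated : ∀ r ∈ R, r ∈ A ∨ ∃ y ∈ D, y ∉ R ∧ G.Adj r y
  certified : ∀ z ∈ G.shadowed D, z ∉ R → ∀ r ∈ R, G.Adj z r → ∃ r' ∈ R, r' ≠ r ∧ G.Adj z r'

theorem exists_adj_notMem_ne (hD : G.IsCertifiedDominating D) {z : V} (hz : z ∈ D)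
    (hzs : z ∉ G.shadowed D) (x : V) : ∃ y ∉ D, y ≠ x ∧ G.Adj z y := by
  obtain ⟨x₀, h₀, hx₀⟩ : ∃ x, G.Adj z x ∧ x ∉ D := by
    by_contra! h
    exact hzs ⟨hz, h⟩
  by_cases h : x₀ = x
  · subst h
    exact (isCertifiedDominating_iff.1 hD).2 z hz x₀ hx₀ h₀
  · exact ⟨x₀, hx₀, h, h₀⟩

theorem IsRemovable.exists_adj_ne {A : Set V} (hR : G.IsRemovable D A R)
    (hD : G.IsCertifiedDominating D) {z : V} (hz : z ∈ D) (hzR : z ∉ R) {x : V}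
    (hx : x ∉ D \ R) (hzx : G.Adj z x) : ∃ y ∉ D \ R, y ≠ x ∧ G.Adj z y := by
  by_cases hzs : z ∈ G.shadowed D
  · have hxR : x ∈ R := by
      by_contra h
      exact hx ⟨hzs.2 x hzx, h⟩
    obtain ⟨y, hy, hyx, hzy⟩ := hR.certified z hzs hzR x hxR hzx
    exact ⟨y, fun h => h.2 hy, hyx, hzy⟩
  · obtain ⟨y, hy, hyx, hzy⟩ := exists_adj_notMem_ne hD hz hzs x
    exact ⟨y, fun h => hy h.1, hyx, hzy⟩

theorem IsRemovable.exists_adj {A : Set V} (hR : G.IsRemovable D A R)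
    (hD : G.IsCertifiedDominating D) {x : V} (hx : x ∉ D \ R) :
    x ∈ A ∨ ∃ y ∈ D \ R, G.Adj x y := by
  by_cases hxR : x ∈ R
  · rcases hR.dominated x hxR with h | ⟨y, hy, hyR, hxy⟩
    · exact Or.inl h
    · exact Or.inr ⟨y, ⟨hy, hyR⟩, hxy⟩
  · have hxD : x ∉ D := fun h => hx ⟨h, hxR⟩
    obtain ⟨y, hy, hxy⟩ := (isCertifiedDominating_iff.1 hD).1 x hxD
    exact Or.inr ⟨y, ⟨hy, fun h => hxD ((hR.subset h).2 x hxy.symm)⟩, hxy⟩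

theorem IsRemovable.isCertifiedDominating_diff (hR : G.IsRemovable D ∅ R)
    (hD : G.IsCertifiedDominating D) : G.IsCertifiedDominating (D \ R) := by
  refine isCertifiedDominating_iff.2 ⟨fun x hx => ?_, fun z hz x hx hzx =>
    hR.exists_adj_ne hD hz.1 hz.2 hx hzx⟩
  simpa using hR.exists_adj hD hx

theorem IsRemovable.eq_empty [Finite V] (hR : G.IsRemovable D ∅ R)
    (hD : G.IsCertifiedDominating D) (hmin : D.ncard = G.certifiedDominationNumber) :
    R = ∅ := by
  by_contra h
  obtain ⟨r, hr⟩ := Set.nonempty_iff_ne_empty.2 h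
  have h1 := certifiedDominationNumber_le (hR.isCertifiedDominating_diff hD)
  have h2 : (D \ R).ncard < D.ncard := Set.ncard_lt_ncard
    ⟨Set.sdiff_subset, fun h => (h (hR.subset hr).1).2 hr⟩ D.toFinite
  omega

/-! ### Two certified dominating sets of the extended graph -/

/-- The witness is `D \ R` together with the new vertex, which dominates the members of `R` lying in
`S`; `hS` is exactly its own certification. -/
theorem certifiedDominationNumber_addVertex_le_of_isRemovable [Finite V]
    (hD : G.IsCertifiedDominating D) (hR : G.IsRemovable D S R)
    (hS : ∀ x ∈ S, x ∉ D \ R → ∃ y ∈ S, y ∉ D \ R ∧ y ≠ x) :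
    (G.addVertex S).certifiedDominationNumber ≤ D.ncard + 1 := by
  have key : (G.addVertex S).IsCertifiedDominating (insert none (some '' (D \ R))) := by
    refine isCertifiedDominating_iff.2 ⟨?_, ?_⟩
    · rintro (_ | x) hx
      · simp at hx
      · have hx' : x ∉ D \ R := by simpa using hx
        rcases hR.exists_adj hD hx' with h | ⟨y, hy, hxy⟩
        · exact ⟨none, by simp, h⟩
        · exact ⟨some y, by simpa using hy, hxy⟩
    · rintro (_ | z) hz (_ | x) hx hzx
      · simp at hx
      · obtain ⟨y, hy, hyD, hyx⟩ := hS x hzx (by simpa using hx)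
        exact ⟨some y, by simpa using hyD, by simpa using hyx, hy⟩
      · simp at hx
      · have hz' : z ∈ D \ R := by simpa using hz
        obtain ⟨y, hyD, hyx, hy⟩ := hR.exists_adj_ne hD hz'.1 hz'.2
          (x := x) (by simpa using hx) hzx
        exact ⟨some y, by simpa using hyD, by simpa using hyx, hy⟩
  refine (certifiedDominationNumber_le key).trans ((Set.ncard_insert_le _ _).trans ?_)
  rw [Set.ncard_image_of_injective _ (Option.some_injective V)]
  exact Nat.add_le_add_right (Set.ncard_le_ncard Set.sdiff_subset D.toFinite) 1

/-- The new vertex stays outside and is dominated from `S ∩ D`. A shadowed vertex of `S` would see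
only that one outside vertex, so its pendant neighbours outside `S` are released too. -/
theorem certifiedDominationNumber_addVertex_le_of_pendant [Finite V]
    (hD : G.IsCertifiedDominating D) (hne : (S ∩ D).Nonempty)
    (h : ∀ a ∈ S, a ∈ G.shadowed D → ∃ x, G.IsPendant x ∧ G.Adj a x ∧ x ∉ S) :
    (G.addVertex S).certifiedDominationNumber ≤ D.ncard := by
  set R : Set V := {x | G.IsPendant x ∧ x ∉ S ∧ ∃ a ∈ S, a ∈ G.shadowed D ∧ G.Adj a x} with hRdef
  have key : (G.addVertex S).IsCertifiedDominating (some '' (D \ R)) := by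
    have hRS : ∀ a ∈ S, a ∉ R := fun a ha haR => haR.2.1 ha
    refine isCertifiedDominating_iff.2 ⟨?_, ?_⟩
    · rintro (_ | x) hx
      · obtain ⟨a, ha, haD⟩ := hne
        exact ⟨some a, by simpa using ⟨haD, hRS a ha⟩, ha⟩
      · by_cases hxR : x ∈ R
        · obtain ⟨-, -, a, ha, has, hax⟩ := hxR
          exact ⟨some a, by simpa using ⟨has.1, hRS a ha⟩, hax.symm⟩
        · have hxD : x ∉ D := fun hxD => hx (by simpa using ⟨hxD, hxR⟩)
          obtain ⟨y, hy, hxy⟩ := (isCertifiedDominating_iff.1 hD).1 x hxD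
          refine ⟨some y, ⟨y, ⟨hy, fun hyR => ?_⟩, rfl⟩, hxy⟩
          obtain ⟨⟨b, -, hb⟩, -, a, -, has, hay⟩ := hyR
          exact hxD ((hb a hay.symm).trans (hb x hxy.symm).symm ▸ has.1)
    · rintro (_ | z) hz t ht hzt
      · simp at hz
      · have hz' : z ∈ D \ R := by simpa using hz
        by_cases hzs : z ∈ G.shadowed D
        · have hzS : z ∈ S := by
            rcases t with _ | x
            · exact hzt
            · have hxR : x ∈ R := by
                by_contra hxR
                exact ht ⟨x, ⟨hzs.2 x hzt, hxR⟩, rfl⟩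
              obtain ⟨⟨b, -, hb⟩, -, a, ha, -, hax⟩ := hxR
              exact (hb a hax.symm).trans (hb z (G.adj_symm hzt)).symm ▸ ha
          obtain ⟨x, hx, hzx, hxS⟩ := h z hzS hzs
          have hxR : x ∈ R := ⟨hx, hxS, z, hzS, hzs, hzx⟩
          rcases t with _ | t
          · exact ⟨some x, by simp [hxR], by simp, hzx⟩
          · exact ⟨none, by simp, by simp, hzS⟩
        · obtain ⟨y, hy, hyt, hzy⟩ : ∃ y ∉ D, some y ≠ t ∧ G.Adj z y := by
            rcases t with _ | t
            · obtain ⟨y, hy, -, hzy⟩ := exists_adj_notMem_ne hD hz'.1 hzs z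
              exact ⟨y, hy, by simp, hzy⟩
            · simpa using exists_adj_notMem_ne hD hz'.1 hzs t
          exact ⟨some y, by simp [hy], hyt, hzy⟩
  refine (certifiedDominationNumber_le key).trans ?_
  rw [Set.ncard_image_of_injective _ (Option.some_injective V)]
  exact Set.ncard_le_ncard Set.sdiff_subset D.toFinite

/-! ### Structure of minimum certified dominating sets -/

/-- In a minimum certified dominating set, a shadowed vertex with at least two neighbours is
adjacent to a vertex of degree one. -/
theorem exists_isPendant_adj [Finite V] (hD : G.IsCertifiedDominating D)
    (hmin : D.ncard = G.certifiedDominationNumber) {a b c : V} (ha : a ∈ G.shadowed D)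
    (hab : G.Adj a b) (hac : G.Adj a c) (hbc : b ≠ c) : ∃ x, G.IsPendant x ∧ G.Adj a x := by
  set T : Set V := {s | s ∈ G.shadowed D ∧ (∀ u, ∃ y, y ≠ u ∧ G.Adj s y) ∧
    ∀ x, G.IsPendant x → ¬ G.Adj s x} with hT
  by_contra! hcon
  have haT : a ∈ T := by
    refine ⟨ha, fun u => ?_, hcon⟩
    by_cases h : b = u
    · exact ⟨c, fun hc => hbc (h.trans hc.symm), hac⟩
    · exact ⟨b, h, hab⟩
  -- `T` collects the potential counterexamples. `F K` says that `K` may stay while `T \ K` is still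
  -- dominated from `D`; `nb K` counts the vertices of `K` that would be dominated without
  -- themselves. The pair is minimised lexicographically.
  let F : Set V → Prop := fun K => K ⊆ T ∧
    ∀ s ∈ T, s ∉ K → ∃ y ∈ D, (y ∈ T → y ∈ K) ∧ G.Adj s y
  let nb : Set V → Set V := fun K => {k | k ∈ K ∧ ∃ y ∈ D, (y ∈ T → y ∈ K) ∧ G.Adj k y}
  obtain ⟨K, hK, hKmin⟩ : ∃ K, F K ∧ ∀ K', F K' →
      ¬ toLex (K'.ncard, (nb K').ncard) < toLex (K.ncard, (nb K).ncard) := by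
    have hwf : WellFounded (fun K K' : Set V =>
        toLex (K.ncard, (nb K).ncard) < toLex (K'.ncard, (nb K').ncard)) :=
      InvImage.wf (fun K : Set V => toLex (K.ncard, (nb K).ncard)) wellFounded_lt
    obtain ⟨K, hK, h⟩ := hwf.has_min {K | F K} ⟨T, subset_rfl, fun s hs hs' => absurd hs hs'⟩
    exact ⟨K, hK, h⟩
  -- No vertex of `K` is redundant.
  have hred : ∀ k ∈ K, ¬ F (K \ {k}) := fun k hk hF => hKmin _ hF
    (Prod.Lex.toLex_lt_toLex.2 (Or.inl (Set.ncard_sdiff_singleton_lt_of_mem hk K.toFinite)))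
  -- A vertex of `K` has no unique neighbour in `T \ K`.
  have hbad : ∀ k ∈ K, ∀ u ∈ T, u ∉ K → G.Adj k u → ∃ r ∈ T, r ∉ K ∧ r ≠ u ∧ G.Adj k r := by
    intro k hk u hu huK hku
    by_contra! hun
    have hkT := hK.1 hk
    obtain ⟨y, hyu, hky⟩ := hkT.2.1 u
    have hyD : y ∈ D := hkT.1.2 y hky
    have hyK : y ∈ T → y ∈ K := fun hyT => by
      by_contra hyK
      exact hun y hyT hyK hyu hky
    obtain ⟨s, hsT, hsK, hs⟩ : ∃ s ∈ T, s ∉ K \ {k} ∧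
        ∀ y ∈ D, (y ∈ T → y ∈ K \ {k}) → ¬ G.Adj s y := by
      by_contra! h
      exact hred k hk ⟨Set.sdiff_subset.trans hK.1, h⟩
    have hsk : s ≠ k := by
      rintro rfl
      exact hs y hyD (fun h => ⟨hyK h, hky.ne'⟩) hky
    have hsK' : s ∉ K := fun h => hsK ⟨h, hsk⟩
    -- A vertex of `T \ K` dominated only by `k` is `u`.
    have huniq : ∀ s ∈ T, s ∉ K →
        (∀ y ∈ D, (y ∈ T → y ∈ K \ {k}) → ¬ G.Adj s y) → s = u := by
      intro s hsT hsK hs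
      obtain ⟨y, hyD, hyK, hsy⟩ := hK.2 s hsT hsK
      by_cases hyk : y = k
      · rw [hyk] at hsy
        by_contra hsu
        exact hun s hsT hsK hsu hsy.symm
      · exact absurd hsy (hs y hyD fun h => ⟨hyK h, hyk⟩)
    obtain rfl := huniq s hsT hsK' hs
    -- Exchanging `k` for its private neighbour `s` keeps the size but shrinks `nb`: `k` leaves it,
    -- and `s`, dominated only by `k`, does not enter.
    have hF' : F (insert s (K \ {k})) := by
      refine ⟨Set.insert_subset hsT (Set.sdiff_subset.trans hK.1), fun t ht htK => ?_⟩
      by_cases htk : t = k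
      · subst htk
        exact ⟨s, hsT.1.1, fun _ => Set.mem_insert _ _, hku⟩
      · have hts : t ≠ s := fun h => htK (h ▸ Set.mem_insert _ _)
        have htK' : t ∉ K := fun h => htK (Set.mem_insert_of_mem _ ⟨h, htk⟩)
        by_contra! h
        exact hts (huniq t ht htK' fun y hy hy' => h y hy fun hyT =>
          Set.mem_insert_of_mem _ (hy' hyT))
    have hlt : (nb (insert s (K \ {k}))).ncard < (nb K).ncard := by
      refine Set.ncard_lt_ncard (Set.ssubset_iff_of_subset ?_ |>.2
        ⟨k, ⟨hk, y, hyD, hyK, hky⟩, fun h => ?_⟩) (Set.toFinite _)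
      · rintro t ⟨ht, x, hxD, hx, htx⟩
        have hts : t ≠ s := by
          rintro rfl
          refine hs x hxD (fun hxT => ?_) htx
          exact (hx hxT).resolve_left htx.ne'
        have htK : t ∈ K \ {k} := ht.resolve_left hts
        refine ⟨htK.1, x, hxD, fun hxT => ?_, htx⟩
        rcases hx hxT with rfl | h
        · exact absurd htx.symm (hs t (hK.1 htK.1).1.1 fun _ => htK)
        · exact h.1
      · rcases h.1 with h | h
        · exact hsk h.symm
        · exact h.2 rfl
    refine hKmin _ hF' (Prod.Lex.toLex_lt_toLex.2 (Or.inr ⟨?_, hlt⟩))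
    exact Set.ncard_exchange hsK' hk
  have hTnp : ∀ s ∈ T, ¬ G.IsPendant s := by
    rintro s hs ⟨y, -, hy⟩
    obtain ⟨t, hty, hst⟩ := hs.2.1 y
    exact hty (hy t hst)
  -- A shadowed vertex outside `T` that loses a neighbour from `T \ K` has a pendant neighbour;
  -- releasing that too gives it a second outside neighbour.
  let R : Set V := {r | r ∈ T ∧ r ∉ K} ∪ {x | x ∈ G.shadowed D ∧ G.IsPendant x ∧
    ∃ p, G.Adj x p ∧ p ∉ T ∧ ∃ s ∈ T, s ∉ K ∧ G.Adj p s}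
  have hR : G.IsRemovable D ∅ R := by
    refine ⟨?_, ?_, ?_⟩
    · rintro r (hr | hr)
      · exact hr.1.1
      · exact hr.1
    · rintro r (⟨hrT, hrK⟩ | ⟨hrs, hrp, p, hrp', hpT, s, hsT, hsK, hps⟩)
      · obtain ⟨y, hyD, hyK, hry⟩ := hK.2 r hrT hrK
        refine Or.inr ⟨y, hyD, ?_, hry⟩
        rintro (h | h)
        · exact h.2 (hyK h.1)
        · exact hrT.2.2 y h.2.1 hry
      · refine Or.inr ⟨p, hrs.2 p hrp', ?_, hrp'⟩
        rintro (h | h)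
        · exact hpT h.1
        · obtain ⟨y, -, hy⟩ := h.2.1
          have : r = s := (hy r hrp'.symm).trans (hy s hps).symm
          exact hTnp s hsT (this ▸ hrp)
    · rintro z hzs hzR r (⟨hrT, hrK⟩ | ⟨hrs, hrp, p, hrp', hpT, s, hsT, hsK, hps⟩) hzr
      · by_cases hzT : z ∈ T
        · have hzK : z ∈ K := by
            by_contra h
            exact hzR (Or.inl ⟨hzT, h⟩)
          obtain ⟨r', h1, h2, h3, h4⟩ := hbad z hzK r hrT hrK hzr
          exact ⟨r', Or.inl ⟨h1, h2⟩, h3, h4⟩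
        · have hzp : ¬ G.IsPendant z := fun h => hrT.2.2 z h hzr.symm
          have hz2 : ∀ u, ∃ y, y ≠ u ∧ G.Adj z y := by
            intro u
            by_contra! h
            have hru : r = u := by
              by_contra hru
              exact h r hru hzr
            subst hru
            exact hzp ⟨r, hzr, fun t ht => by
              by_contra htr
              exact h t htr ht⟩
          obtain ⟨x, hxp, hzx⟩ : ∃ x, G.IsPendant x ∧ G.Adj z x := by
            by_contra! h
            exact hzT ⟨hzs, hz2, h⟩
          have hxs : x ∈ G.shadowed D := by
            refine ⟨hzs.2 x hzx, fun t ht => ?_⟩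
            obtain ⟨y, -, hy⟩ := hxp
            exact (hy z hzx.symm).trans (hy t ht).symm ▸ hzs.1
          exact ⟨x, Or.inr ⟨hxs, hxp, z, hzx.symm, hzT, r, hrT, hrK, hzr⟩,
            fun h => hTnp r hrT (h ▸ hxp), hzx⟩
      · obtain ⟨y, -, hy⟩ := id hrp
        obtain rfl : z = p := (hy z hzr.symm).trans (hy p hrp').symm
        exact ⟨s, Or.inl ⟨hsT, hsK⟩, fun h => hTnp s hsT (h ▸ hrp), hps⟩
  have hR0 := hR.eq_empty hD hmin
  have haK : a ∈ K := by
    by_contra h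
    have : a ∈ R := Or.inl ⟨haT, h⟩
    simp [hR0] at this
  -- Now `K = T`, yet `a` is redundant in it because `b` dominates `a`.
  refine hred a haK ⟨Set.sdiff_subset.trans hK.1, fun s hs hsK => ?_⟩
  have hTK : ∀ t ∈ T, t ∈ K := by
    intro t ht
    by_contra h
    have : t ∈ R := Or.inl ⟨ht, h⟩
    simp [hR0] at this
  obtain rfl : s = a := by
    by_contra h
    exact hsK ⟨hTK s hs, h⟩
  exact ⟨b, ha.2 b hab, fun hb => ⟨hTK b hb, hab.ne'⟩, hab⟩

/-- In a minimum certified dominating set, the neighbour of a shadowed vertex of degree one is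
shadowed. -/
theorem IsPendant.mem_shadowed_of_adj [Finite V] (hD : G.IsCertifiedDominating D)
    (hmin : D.ncard = G.certifiedDominationNumber) {a b : V} (ha : a ∈ G.shadowed D)
    (hp : G.IsPendant a) (hab : G.Adj a b) : b ∈ G.shadowed D := by
  by_contra hb
  obtain ⟨y, -, hy⟩ := hp
  have hR : G.IsRemovable D ∅ {a} := by
    refine ⟨by simpa using ha, ?_, ?_⟩
    · rintro r rfl
      exact Or.inr ⟨b, ha.2 b hab, hab.ne', hab⟩
    · rintro z hzs - r rfl hzr
      exact absurd ((hy z hzr.symm).trans (hy b hab).symm ▸ hzs) hb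
  simpa using hR.eq_empty hD hmin

/-- In a minimum certified dominating set, distinct shadowed vertices of degree one have distinct
neighbours. -/
theorem IsPendant.eq_of_adj [Finite V] (hD : G.IsCertifiedDominating D)
    (hmin : D.ncard = G.certifiedDominationNumber) {a b c : V} (ha : a ∈ G.shadowed D)
    (hc : c ∈ G.shadowed D) (hpa : G.IsPendant a) (hpc : G.IsPendant c)
    (hab : G.Adj a b) (hcb : G.Adj c b) : a = c := by
  by_contra hac
  obtain ⟨y, -, hy⟩ := hpa
  obtain ⟨x, -, hx⟩ := hpc
  have hR : G.IsRemovable D ∅ {a, c} := by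
    have hb : b ∉ ({a, c} : Set V) := by
      rintro (h | h)
      · exact hab.ne' h
      · exact hcb.ne' h
    refine ⟨?_, ?_, ?_⟩
    · rintro r (rfl | rfl)
      exacts [ha, hc]
    · rintro r (rfl | rfl)
      · exact Or.inr ⟨b, ha.2 b hab, hb, hab⟩
      · exact Or.inr ⟨b, ha.2 b hab, hb, hcb⟩
    · rintro z - - r (rfl | rfl) hzr
      · obtain rfl : z = b := (hy z hzr.symm).trans (hy b hab).symm
        exact ⟨c, by simp, Ne.symm hac, hcb.symm⟩
      · obtain rfl : z = b := (hx z hzr.symm).trans (hx b hcb).symm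
        exact ⟨a, by simp, hac, hab.symm⟩
  exact (Set.insert_nonempty _ _).ne_empty (hR.eq_empty hD hmin)

/-- A shadowed vertex of degree one whose neighbour has further neighbours lies in a removable
set, as soon as it is dominated from elsewhere. -/
theorem exists_isRemovable_of_isPendant [Finite V] (hD : G.IsCertifiedDominating D)
    (hmin : D.ncard = G.certifiedDominationNumber) {a b : V} (haS : a ∈ S)
    (ha : a ∈ G.shadowed D) (hp : G.IsPendant a) (hab : G.Adj a b) (hb : ¬ G.IsPendant b) :
    ∃ R, a ∈ R ∧ G.IsRemovable D S R := by
  have hbs := hp.mem_shadowed_of_adj hD hmin ha hab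
  have hpa : ∀ z, G.Adj a z → z = b := by
    obtain ⟨y, -, hy⟩ := hp
    exact fun z hz => (hy z hz).trans (hy b hab).symm
  obtain ⟨c, hca, hbc⟩ : ∃ c, c ≠ a ∧ G.Adj b c := by
    by_contra! h
    exact hb ⟨a, hab.symm, fun z hz => by
      by_contra hza
      exact h z hza hz⟩
  have hnp : ∀ c, c ≠ a → G.Adj b c → ¬ G.IsPendant c := by
    intro c hca hbc hcp
    have hcs : c ∈ G.shadowed D := by
      refine ⟨hbs.2 c hbc, fun t ht => ?_⟩
      obtain ⟨y, -, hy⟩ := hcp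
      exact (hy b hbc.symm).trans (hy t ht).symm ▸ hbs.1
    exact hca (IsPendant.eq_of_adj hD hmin hcs ha hcp hp hbc.symm hab)
  -- The other neighbours of `b` stay and dominate it; a shadowed one, having lost `b`, needs a
  -- second outside neighbour, hence the pendant vertices.
  refine ⟨{a, b} ∪ {x | x ∈ G.shadowed D ∧ G.IsPendant x ∧ ∃ c, c ≠ a ∧ G.Adj b c ∧ G.Adj x c},
    by simp, ?_, ?_, ?_⟩
  · rintro r ((rfl | rfl) | hr)
    exacts [ha, hbs, hr.1]
  · have hcR : ∀ c, c ≠ a → G.Adj b c → c ∉ ({a, b} ∪ {x | x ∈ G.shadowed D ∧ G.IsPendant x ∧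
        ∃ c, c ≠ a ∧ G.Adj b c ∧ G.Adj x c} : Set V) := by
      rintro c hca hbc ((h | h) | h)
      · exact hca h
      · exact hbc.ne' h
      · exact hnp c hca hbc h.2.1
    rintro r ((rfl | rfl) | ⟨-, -, d, hda, hbd, hrd⟩)
    · exact Or.inl haS
    · exact Or.inr ⟨c, hbs.2 c hbc, hcR c hca hbc, hbc⟩
    · exact Or.inr ⟨d, hbs.2 d hbd, hcR d hda hbd, hrd⟩
  · rintro z hzs hzR r hr hzr
    have hza : z ≠ a := fun h => hzR (by simp [h])
    have hzb : z ≠ b := fun h => hzR (by simp [h])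
    rcases hr with (rfl | rfl) | ⟨-, hrp, d, hda, hbd, hrd⟩
    · exact absurd (hpa z hzr.symm) hzb
    · obtain ⟨u, hur, hzu⟩ : ∃ u, u ≠ r ∧ G.Adj z u := by
        by_contra! h
        exact hnp z hza hzr.symm ⟨r, hzr, fun t ht => by
          by_contra htr
          exact h t htr ht⟩
      obtain ⟨x, hxp, hzx⟩ := exists_isPendant_adj hD hmin hzs hzr hzu hur.symm
      have hxs : x ∈ G.shadowed D := by
        refine ⟨hzs.2 x hzx, fun t ht => ?_⟩
        obtain ⟨y, -, hy⟩ := hxp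
        exact (hy z hzx.symm).trans (hy t ht).symm ▸ hzs.1
      exact ⟨x, Or.inr ⟨hxs, hxp, z, hza, hzr.symm, hzx.symm⟩, fun h => hb (h ▸ hxp), hzx⟩
    · obtain ⟨y, -, hy⟩ := id hrp
      obtain rfl : z = d := (hy z hzr.symm).trans (hy d hrd).symm
      exact ⟨b, by simp, fun h => hb (h ▸ hrp), hbd.symm⟩

/-! ### The upper bound of part (a) -/

theorem certifiedDominationNumber_addVertex_le [Finite V] (G : SimpleGraph V) (S : Set V)
    (hS : ∀ x ∈ S, ∃ y ∈ S, y ≠ x) :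
    (G.addVertex S).certifiedDominationNumber ≤ G.certifiedDominationNumber + 1 := by
  obtain ⟨D, hD, hmin⟩ := exists_isCertifiedDominating_ncard_eq G
  rw [← hmin]
  by_cases h1 : ∀ x ∈ S, x ∉ D → ∃ y ∈ S, y ∉ D ∧ y ≠ x
  · exact certifiedDominationNumber_addVertex_le_of_isRemovable (R := ∅) hD
      ⟨by simp, by simp, by simp⟩ (by simpa using h1)
  push Not at h1
  obtain ⟨w, hwS, hwD, hw⟩ := h1
  -- Both `w` and `a` are outside neighbours of the new vertex.
  have finish : ∀ a R, a ∈ S → a ∈ R → G.IsRemovable D S R →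
      (G.addVertex S).certifiedDominationNumber ≤ D.ncard + 1 := by
    intro a R haS haR hR
    refine certifiedDominationNumber_addVertex_le_of_isRemovable hD hR fun x _ _ => ?_
    have haw : a ≠ w := fun h => hwD (h ▸ (hR.subset haR).1)
    by_cases hxa : x = a
    · exact ⟨w, hwS, fun h => hwD h.1, fun h => haw (h.trans hxa).symm⟩
    · exact ⟨a, haS, fun h => h.2 haR, Ne.symm hxa⟩
  by_cases h2 : ∀ a ∈ S, a ∈ G.shadowed D → ∃ x, G.IsPendant x ∧ G.Adj a x ∧ x ∉ S
  · obtain ⟨y, hyS, hyw⟩ := hS w hwS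
    have hyD : y ∈ D := by
      by_contra h
      exact hyw (hw y hyS h)
    exact (certifiedDominationNumber_addVertex_le_of_pendant hD ⟨y, hyS, hyD⟩ h2).trans
      (Nat.le_succ _)
  push Not at h2
  obtain ⟨a, haS, has, ha⟩ := h2
  by_cases hiso : ∀ b, ¬ G.Adj a b
  · refine finish a {a} haS rfl ⟨by simpa using has, by simp [haS], ?_⟩
    rintro z - - r rfl hzr
    exact absurd hzr.symm (hiso z)
  push Not at hiso
  obtain ⟨b, hab⟩ := hiso
  by_cases hap : G.IsPendant a
  · by_cases hbp : G.IsPendant b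
    · have hbS := ha b hbp hab
      obtain ⟨x, -, hx⟩ := hap
      obtain ⟨y, -, hy⟩ := hbp
      refine finish a {a, b} haS (by simp) ⟨?_, ?_, ?_⟩
      · rintro r (rfl | rfl)
        · exact has
        · refine ⟨has.2 r hab, fun t ht => ?_⟩
          exact (hy a hab.symm).trans (hy t ht).symm ▸ has.1
      · rintro r (rfl | rfl)
        exacts [Or.inl haS, Or.inl hbS]
      · rintro z - hz r (rfl | rfl) hzr
        · exact absurd ((hx z hzr.symm).trans (hx b hab).symm) (fun h => hz (by simp [h]))
        · exact absurd ((hy z hzr.symm).trans (hy a hab.symm).symm) (fun h => hz (by simp [h]))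
    · obtain ⟨R, haR, hR⟩ := exists_isRemovable_of_isPendant hD hmin haS has hap hab hbp
      exact finish a R haS haR hR
  · obtain ⟨c, hcb, hac⟩ : ∃ c, c ≠ b ∧ G.Adj a c := by
      by_contra! h
      exact hap ⟨b, hab, fun t ht => by
        by_contra htb
        exact h t htb ht⟩
    obtain ⟨x, hxp, hax⟩ := exists_isPendant_adj hD hmin has hab hac hcb.symm
    have hxS := ha x hxp hax
    have hxs : x ∈ G.shadowed D := by
      refine ⟨has.2 x hax, fun t ht => ?_⟩
      obtain ⟨y, -, hy⟩ := hxp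
      exact (hy a hax.symm).trans (hy t ht).symm ▸ has.1
    obtain ⟨R, hxR, hR⟩ := exists_isRemovable_of_isPendant hD hmin hxS hxs hxp hax.symm hap
    exact finish x R hxS hxR hR

/-! ### The example of part (b) -/

/-- The star with `i` rays, each subdivided once: the centre is `0`, the middle vertices are
`1, …, i`, and the end vertex next to `j` is `j + i`. -/
def subdividedStar (i : ℕ) : SimpleGraph (Fin (2 * i + 1)) where
  Adj a b := (a.val = 0 ∧ 1 ≤ b.val ∧ b.val ≤ i) ∨ (b.val = 0 ∧ 1 ≤ a.val ∧ a.val ≤ i) ∨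
    (1 ≤ a.val ∧ b.val = a.val + i) ∨ (1 ≤ b.val ∧ a.val = b.val + i)
  symm := ⟨fun a b h => by omega⟩
  loopless := ⟨fun a h => by omega⟩

theorem subdividedStar_adj {i : ℕ} {a b : Fin (2 * i + 1)} : (subdividedStar i).Adj a b ↔
    (a.val = 0 ∧ 1 ≤ b.val ∧ b.val ≤ i) ∨ (b.val = 0 ∧ 1 ≤ a.val ∧ a.val ≤ i) ∨
    (1 ≤ a.val ∧ b.val = a.val + i) ∨ (1 ≤ b.val ∧ a.val = b.val + i) := Iff.rfl

theorem certifiedDominationNumber_subdividedStar {i : ℕ} (hi : 1 ≤ i) :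
    (subdividedStar i).certifiedDominationNumber = i := by
  apply le_antisymm
  · have key : (subdividedStar i).IsCertifiedDominating {x | 1 ≤ x.val ∧ x.val ≤ i} := by
      refine isCertifiedDominating_iff.2 ⟨fun v hv => ?_, fun v hv x hx hvx => ?_⟩
      · simp only [Set.mem_ofPred_eq] at hv
        by_cases h0 : v.val = 0
        · exact ⟨⟨1, by omega⟩, ⟨le_rfl, hi⟩, Or.inl ⟨h0, le_rfl, hi⟩⟩
        · exact ⟨⟨v.val - i, by omega⟩, ⟨by simp; omega, by simp; omega⟩,
            by rw [subdividedStar_adj]; simp; omega⟩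
      · simp only [Set.mem_ofPred_eq] at hv hx
        by_cases h0 : x.val = 0
        · refine ⟨⟨v.val + i, by omega⟩, fun h => absurd h.2 (by simp only; omega), ?_, ?_⟩
          · rw [Ne, Fin.ext_iff]; simp; omega
          · rw [subdividedStar_adj]; simp; omega
        · refine ⟨⟨0, by omega⟩, by simp, ?_, ?_⟩
          · rw [Ne, Fin.ext_iff]; simp; omega
          · rw [subdividedStar_adj]; simp; omega
    refine (certifiedDominationNumber_le key).trans ?_
    have h := Set.ncard_le_ncard_of_injOn (s := {x : Fin (2 * i + 1) | 1 ≤ x.val ∧ x.val ≤ i})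
      (t := (Finset.Icc 1 i : Set ℕ)) Fin.val (fun x hx => by simpa using hx)
      Fin.val_injective.injOn (Finset.finite_toSet _)
    rwa [Set.ncard_coe_finset, Nat.card_Icc, Nat.add_sub_cancel] at h
  · obtain ⟨D, hD, hcard⟩ := (subdividedStar i).isLeast_certifiedDominationNumber.1
    rw [← hcard]
    -- Each ray meets `D`, since its end vertex or that vertex's only neighbour must lie in `D`; the
    -- map sends both to the index of the ray.
    have h : Finset.Icc 1 i ⊆ D.image fun x => if x.val ≤ i then x.val else x.val - i := by
      intro j hj
      rw [Finset.mem_Icc] at hj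
      rw [Finset.mem_image]
      by_cases hl : (⟨j + i, by omega⟩ : Fin (2 * i + 1)) ∈ D
      · refine ⟨_, hl, ?_⟩
        rw [if_neg (by simp; omega)]
        simp
      · obtain ⟨w, hw, hadj⟩ := (isCertifiedDominating_iff.1 hD).1 _ (by simpa using hl)
        rw [subdividedStar_adj] at hadj
        simp only at hadj
        refine ⟨w, by simpa using hw, ?_⟩
        rw [if_pos (by omega)]
        omega
    have := (Finset.card_le_card h).trans Finset.card_image_le
    rwa [Nat.card_Icc, Nat.add_sub_cancel] at this

/-- The centre and all middle vertices now support a pendant vertex, so they lie in `D`. Each then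
has at most one outside neighbour, its pendant vertex, and certification excludes exactly one. -/
theorem eq_univ_of_isCertifiedDominating_addVertex_subdividedStar {i : ℕ} (hi : 1 ≤ i)
    {D : Set (Option (Fin (2 * i + 1)))}
    (hD : ((subdividedStar i).addVertex {0}).IsCertifiedDominating D) : D = Set.univ := by
  rw [isCertifiedDominating_iff] at hD
  -- The neighbour of a pendant vertex is in `D`.
  have hsupp : ∀ l s, ((subdividedStar i).addVertex {0}).Adj l s →
      (∀ t, ((subdividedStar i).addVertex {0}).Adj l t → t = s) → s ∈ D := by
    intro l s hls hl
    by_contra hs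
    by_cases hlD : l ∈ D
    · obtain ⟨y, -, hys, hly⟩ := hD.2 l hlD s hs hls
      exact hys (hl y hly)
    · obtain ⟨w, hw, hlw⟩ := hD.1 l hlD
      exact hs (hl w hlw ▸ hw)
  have h0 : some 0 ∈ D := by
    refine hsupp none (some 0) rfl ?_
    rintro (_ | t) ht
    · exact ht.elim
    · exact congrArg some ht
  have hmid : ∀ j : Fin (2 * i + 1), 1 ≤ j.val → j.val ≤ i → some j ∈ D := by
    intro j hj1 hj2
    refine hsupp (some ⟨j.val + i, by omega⟩) (some j) (Or.inr (Or.inr (Or.inr ⟨hj1, rfl⟩))) ?_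
    rintro (_ | t) ht
    · have := congrArg Fin.val (show (⟨j.val + i, by omega⟩ : Fin (2 * i + 1)) = 0 from ht)
      simp at this
      omega
    · have ht' := subdividedStar_adj.1
        (show (subdividedStar i).Adj ⟨j.val + i, by omega⟩ t from ht)
      simp only at ht'
      exact congrArg some (Fin.ext (by omega))
  refine Set.eq_univ_of_forall ?_
  rintro (_ | x)
  · by_contra hn
    obtain ⟨y, hyD, hyn, hy⟩ := hD.2 _ h0 none hn rfl
    rcases y with _ | y
    · exact hyn rfl
    · have hy' := subdividedStar_adj.1 (show (subdividedStar i).Adj 0 y from hy)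
      simp only [Fin.val_zero] at hy'
      exact hyD (hmid y (by omega) (by omega))
  · by_cases hx0 : x.val = 0
    · rwa [show x = 0 from Fin.ext hx0]
    by_cases hxi : x.val ≤ i
    · exact hmid x (by omega) hxi
    by_contra hx
    have hj := hmid ⟨x.val - i, by omega⟩ (by simp; omega) (by simp; omega)
    obtain ⟨y, hyD, hyx, hy⟩ := hD.2 _ hj (some x) hx
      (Or.inr (Or.inr (Or.inl ⟨by simp; omega, by simp; omega⟩)))
    rcases y with _ | y
    · have := congrArg Fin.val (show (⟨x.val - i, by omega⟩ : Fin (2 * i + 1)) = 0 from hy)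
      simp at this
      omega
    · have hy' := subdividedStar_adj.1
        (show (subdividedStar i).Adj ⟨x.val - i, by omega⟩ y from hy)
      simp only at hy'
      by_cases hy0 : y.val = 0
      · exact hyD ((show y = 0 from Fin.ext hy0) ▸ h0)
      · exact hyx (congrArg some (Fin.ext (by omega)))

theorem certifiedDominationNumber_addVertex_subdividedStar {i : ℕ} (hi : 1 ≤ i) :
    ((subdividedStar i).addVertex {0}).certifiedDominationNumber = 2 * i + 2 := by
  obtain ⟨D, hD, hcard⟩ :=
    exists_isCertifiedDominating_ncard_eq ((subdividedStar i).addVertex {0})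
  rw [← hcard, eq_univ_of_isCertifiedDominating_addVertex_subdividedStar hi hD, Set.ncard_univ]
  simp

theorem addVertex_neighborSet_none (G : SimpleGraph V) (S : Set V) :
    (G.addVertex S).neighborSet none = some '' S := by
  ext (_ | x)
  · simp [addVertex]
  · simp [addVertex]

theorem encard_addVertex_neighborSet_none (G : SimpleGraph V) (S : Set V) :
    ((G.addVertex S).neighborSet none).encard = S.encard := by
  rw [addVertex_neighborSet_none, (Option.some_injective V).encard_image]

end SimpleGraph

open SimpleGraph in
theorem mainTheorem7 :
    (∀ {V : Type*} [Finite V] (G : SimpleGraph V) (S : Set V),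
      ((G.addVertex S).neighborSet none).encard ≠ 1 →
        (G.addVertex S).certifiedDominationNumber ≤ G.certifiedDominationNumber + 1) ∧
    (∀ i : ℕ, 1 ≤ i → ∃ (G : SimpleGraph (Fin (2 * i + 1))) (S : Set (Fin (2 * i + 1))),
      ((G.addVertex S).neighborSet none).encard = 1 ∧
        G.certifiedDominationNumber = i ∧
        (G.addVertex S).certifiedDominationNumber = 2 * i + 2) := by
  refine ⟨fun G S hS => certifiedDominationNumber_addVertex_le G S fun x hx => ?_,
    fun i hi => ⟨subdividedStar i, {0}, ?_, certifiedDominationNumber_subdividedStar hi,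
      certifiedDominationNumber_addVertex_subdividedStar hi⟩⟩
  · rw [encard_addVertex_neighborSet_none] at hS
    by_contra! h
    exact hS (Set.encard_eq_one.2 ⟨x, Set.eq_singleton_iff_unique_mem.2 ⟨hx, h⟩⟩)
  · rw [encard_addVertex_neighborSet_none, Set.encard_singleton]
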